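/- **Conventions.** Logarithms are to base 2. A *prefix machine* is a partial recursive function $T$ from finite binary strings (programs) to finite objects (strings, finite lists of strings, natural numbers, under a standard computable encoding) whose domain is prefix-free. Fix a *universal prefix machine* $U$, i.e. a prefix machine such that for every prefix machine $T$ there is a constant $c_T$ such that whenever $T(y)=a$ there is $z$ with $U(z)=a$ and $l(z)\le l(y)+c_T$. For a finite object $a$, $K(a)$ is the length of a shortest program $p$ with $U(p)=a$. For a finite set $s\subseteq\{0,1\}^*$, $K(s)$ is the length of a shortest program from which $U$ computes a listing of the elements of $s$. For $f:\{0,1\}^*\to[0,\infty)$, $K(f)=\min\{K(i): T_i \text{ computes } f\}$ ($=\infty$ if $f$ is not computable), where $T_1,T_2,\dots$ is a standard enumeration of the Turing machines, and $T_i$ computes $f$ if on each input $\langle x,y\rangle$ with $y\geq 1$ it outputs $\langle p,q\rangle$ with $q\ge 1$ and $|p/q-f(x)|<1/y$. A *sequential information source* is a function $f:\{0,1\}^*\to[0,1]$ with $f(\epsilon)=1$ and $f(x0)+f(x1)=f(x)$ for all $x$; $f^{(n)}$ denotes its restriction to $\{0,1\}^n$, a probability mass function. A *sequential statistic* is a map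 $S:\{0,1\}^*\to 2^{\{0,1\}^*}$ such that for all $n$ and all $x\in\{0,1\}^n$: $S(x)\subseteq\{0,1\}^n$, $x\in S(x)$, and $\{S(x):x\in\{0,1\}^n\}$ is a partition of $\{0,1\}^n$. It is *sufficient in the algorithmic sense* if there is a constant $c$ such that $$K(S(x))+\log|S(x)|\le K(x)+c\qquad\text{for all }x\in\{0,1\}^*.$$ For $x \in \{0,1\}^n$ put $f^{(n)}(x\mid s)=f^{(n)}(x)/\sum_{y\in\{0,1\}^n:\,S(y)=s}f^{(n)}(y)$ if $S(x)=s$, and $f^{(n)}(x\mid s)=0$ otherwise. Let $g^{(n)}$ be the uniform conditional mass function: $g^{(n)}(x\mid s)=1/|\{y\in\{0,1\}^n:S(y)=s\}|$ if $S(x)=s$, and $0$ otherwise. For a family $\{f_\theta\}_{\theta\in\Theta}$ of sequential information sources, consider the inequality $$\Bigl|\sum_{x\in\{0,1\}^n}f_\theta^{(n)}(x)\Bigl[\log\frac1{f_\theta^{(n)}(x\mid S(x))}-\log\frac1{h^{(n)}(x\mid S(x))}\Bigr]\Bigr|\le c,\tag{1}$$ where $\log 1/0=\infty$ and terms with $f_\theta^{(n)}(x)=0$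 are read as $0$. $S$ is *nearly sufficient for $\{f_\theta\}$ in the probabilistic-expectation sense* (with functions $h^{(n)}$) if there are functions $h^{(1)},h^{(2)},\dots$ and a constant $c$ such that (1) holds for all $\theta$ and all $n$. **Theorem.** Let $S$ be a sequential statistic that is sufficient in the algorithmic sense, and let $\{f_\theta\}_{\theta\in\Theta}$ be a family of sequential information sources. Then for every $\theta$ with $K(f_\theta)<\infty$ there is a constant $c$ such that for all $n$ inequality (1) holds with $h^{(n)}=g^{(n)}$, the uniform one. Consequently, if $\sup_{\theta\in\Theta}K(f_\theta)<\infty$, then $S$ is nearly sufficient for $\{f_\theta\}$ in the probabilistic-expectation sense, with $h^{(n)}=g^{(n)}$. -/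

import Mathlib

/-! ### Prefix machines and prefix Kolmogorov complexity -/

/-- A (partial recursive) prefix machine: a partial recursive function from binary programs to
natural numbers whose set of halting programs is prefix-free. Binary strings, lists of strings and
machine indices are output through their standard (computable) encoding in `ℕ`. -/
structure IsPrefixMachine (T : List Bool →. ℕ) : Prop where
  partrec : Partrec T
  prefixFree : ∀ p q : List Bool, (T p).Dom → (T q).Dom → p <+: q → p = q

/-- A universal (reference) prefix machine: it simulates every prefix machine with an additive
overhead in program length which depends only on the simulated machine. -/
structure IsUniversalPrefixMachine (U : List Bool →. ℕ) : Prop where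
  isPrefixMachine : IsPrefixMachine U
  simulates : ∀ T : List Bool →. ℕ, IsPrefixMachine T →
    ∃ c : ℕ, ∀ y : List Bool, ∀ a ∈ T y, ∃ z : List Bool, a ∈ U z ∧ z.length ≤ y.length + c

namespace KolmogorovComplexity

/-- `K(a)`: the length of a shortest program `p` with `U(p) = a` (`⊤` if there is none). -/
noncomputable def ofNat (U : List Bool →. ℕ) (a : ℕ) : ℕ∞ :=
  ⨅ p ∈ {p : List Bool | a ∈ U p}, (p.length : ℕ∞)

/-- `K(x)` for a binary string `x`. -/
noncomputable def ofString (U : List Bool →. ℕ) (x : List Bool) : ℕ∞ :=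
  ofNat U (Encodable.encode x)

/-- `l` is a listing of the elements of `S`. -/
def IsListing (S : Set (List Bool)) (l : List (List Bool)) : Prop :=
  l.Nodup ∧ ∀ x, x ∈ l ↔ x ∈ S

/-- `K(S)` for a finite set `S` of binary strings: the length of a shortest program from which `U`
computes a listing of the elements of `S`. -/
noncomputable def ofSet (U : List Bool →. ℕ) (S : Set (List Bool)) : ℕ∞ :=
  ⨅ l ∈ {l : List (List Bool) | IsListing S l}, ofNat U (Encodable.encode l)

/-- The `i`-th partial recursive function computes the nonnegative real-valued function `f`: on
input `⟨x, y⟩` with `y > 0` it halts with a pair `⟨p, q⟩` such that `|p / q - f(x)| < 1 / y`. -/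
def ComputesReal (i : ℕ) (f : List Bool → ℝ) : Prop :=
  ∀ (x : List Bool) (y : ℕ), 0 < y → ∃ p q : ℕ, 0 < q ∧
    Nat.pair p q ∈ (Denumerable.ofNat Nat.Partrec.Code i).eval (Nat.pair (Encodable.encode x) y) ∧
    |(p : ℝ) / (q : ℝ) - f x| < 1 / (y : ℝ)

/-- `K(f) = min {K(i) : T_i computes f}` for a nonnegative real-valued function `f`; it is `⊤`
if `f` is not computable. -/
noncomputable def ofFun (U : List Bool →. ℕ) (f : List Bool → ℝ) : ℕ∞ :=
  ⨅ i ∈ {i : ℕ | ComputesReal i f}, ofNat U i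

end KolmogorovComplexity

/-! ### Universal prefix machines exist -/

namespace UniversalMachineConstruction

open Encodable
open Nat.Partrec (Code)

/-- Stage `s` of the dovetailed run of the code `c`, on behalf of the program `y`: if a program `z`
comparable with `y` (in the prefix order) halts at this stage, the result is `some _`, and it
carries the output if `z = y`. -/
def step (c : Code) (y : List Bool) (s : ℕ) : Option (Option ℕ) :=
  (decode (α := List Bool) s.unpair.1).bind fun z =>
    (Code.evaln s.unpair.2 c (encode z)).bind fun v =>
      if z.take y.length = y.take z.length then some (if z = y then some v else none) else none

/-- The machine `c` made prefix-free: `y` is accepted iff it is the first program comparable with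
`y` that is seen to halt. -/
def run (c : Code) (y : List Bool) : Part ℕ :=
  (Nat.rfindOpt (step c y)).bind fun o => (o : Part ℕ)

/-- The universal machine: `1ⁱ0y` is mapped to the result of the `i`-th prefix machine on `y`. -/
def machine (p : List Bool) : Part ℕ :=
  ((if p.idxOf false < p.length then some () else none : Option Unit) : Part Unit).bind fun _ =>
    run (Denumerable.ofNat Code (p.idxOf false)) (p.drop (p.idxOf false + 1))

theorem step_primrec : Primrec fun a : (Code × List Bool) × ℕ => step a.1.1 a.1.2 a.2 := by
  have hs : Primrec fun a : (Code × List Bool) × ℕ => a.2.unpair := Primrec.unpair.comp Primrec.snd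
  unfold step
  refine Primrec.option_bind (Primrec.decode.comp (Primrec.fst.comp hs)) ?_
  refine Primrec.option_bind (f := fun q : ((Code × List Bool) × ℕ) × List Bool =>
    Code.evaln q.1.2.unpair.2 q.1.1.1 (encode q.2)) ?_ ?_
  · exact Code.primrec_evaln.comp
      (((Primrec.snd.comp (hs.comp Primrec.fst)).pair
        (Primrec.fst.comp (Primrec.fst.comp Primrec.fst))).pair (Primrec.encode.comp Primrec.snd))
  · have hz : Primrec fun r : (((Code × List Bool) × ℕ) × List Bool) × ℕ => r.1.2 :=
      Primrec.snd.comp Primrec.fst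
    have hy : Primrec fun r : (((Code × List Bool) × ℕ) × List Bool) × ℕ => r.1.1.1.2 :=
      Primrec.snd.comp (Primrec.fst.comp (Primrec.fst.comp Primrec.fst))
    refine Primrec.ite (Primrec.eq.comp
      (Primrec.list_take.comp (Primrec.list_length.comp hy) hz)
      (Primrec.list_take.comp (Primrec.list_length.comp hz) hy)) ?_ (Primrec.const _)
    exact Primrec.option_some.comp (Primrec.ite (Primrec.eq.comp hz hy)
      (Primrec.option_some.comp Primrec.snd) (Primrec.const _))

theorem run_partrec : Partrec₂ run := by
  have h : Partrec fun a : Code × List Bool => Nat.rfindOpt (step a.1 a.2) :=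
    Partrec.rfindOpt (f := fun a : Code × List Bool => step a.1 a.2) step_primrec.to_comp
  exact h.bind (Computable.ofOption Computable.snd)

theorem machine_partrec : Partrec machine := by
  have hi : Primrec fun p : List Bool => p.idxOf false :=
    Primrec.list_idxOf.comp (Primrec.const false) Primrec.id
  have h1 : Primrec fun p : List Bool =>
      (if p.idxOf false < p.length then some () else none : Option Unit) :=
    Primrec.ite (Primrec.nat_lt.comp hi Primrec.list_length) (Primrec.const _) (Primrec.const _)
  refine (Computable.ofOption h1.to_comp).bind ?_
  exact run_partrec.comp
    (((Primrec.ofNat Code).comp (hi.comp Primrec.fst)).to_comp)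
    ((Primrec.list_drop.comp (Primrec.succ.comp (hi.comp Primrec.fst)) Primrec.fst).to_comp)

theorem mem_run {c : Code} {y : List Bool} {a : ℕ} : a ∈ run c y ↔
    ∃ s, step c y s = some (some a) ∧ ∀ t < s, step c y t = none := by
  unfold run
  rw [Part.mem_bind_iff]
  constructor
  · rintro ⟨o, ho, ha⟩
    rw [Part.mem_coe] at ha
    obtain rfl : o = some a := ha
    unfold Nat.rfindOpt at ho
    obtain ⟨s, hs, hs'⟩ := Part.mem_bind_iff.1 ho
    rw [Part.mem_coe] at hs'
    refine ⟨s, hs', fun t ht => ?_⟩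
    have := Nat.rfind_min hs ht
    simpa using this
  · rintro ⟨s, hs, ht⟩
    refine ⟨some a, ?_, by simp⟩
    unfold Nat.rfindOpt
    refine Part.mem_bind_iff.2 ⟨s, ?_, by simp [hs]⟩
    exact Nat.mem_rfind.2 ⟨by simp [hs], fun {t} h => by simp [ht t h]⟩

theorem step_isSome {c : Code} {y : List Bool} {s : ℕ} {o : Option ℕ} :
    step c y s = some o ↔ ∃ z : List Bool, decode s.unpair.1 = some z ∧
      ∃ v, Code.evaln s.unpair.2 c (encode z) = some v ∧
        z.take y.length = y.take z.length ∧ (if z = y then some v else none) = o := by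
  simp [step, Option.bind_eq_some_iff]

theorem step_some_some {c : Code} {y : List Bool} {s a : ℕ} :
    step c y s = some (some a) ↔ decode s.unpair.1 = some y ∧
      Code.evaln s.unpair.2 c (encode y) = some a := by
  rw [step_isSome]
  constructor
  · rintro ⟨z, hz, v, hv, -, h⟩
    split_ifs at h with hzy
    subst hzy
    cases h
    exact ⟨hz, hv⟩
  · rintro ⟨hz, hv⟩
    exact ⟨y, hz, a, hv, rfl, by simp⟩

theorem run_prefixFree (c : Code) (p q : List Bool) (hp : (run c p).Dom) (hq : (run c q).Dom)
    (hpq : p <+: q) : p = q := by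
  obtain ⟨a, ha⟩ := Part.dom_iff_mem.1 hp
  obtain ⟨b, hb⟩ := Part.dom_iff_mem.1 hq
  obtain ⟨s, hs, hs'⟩ := mem_run.1 ha
  obtain ⟨t, ht, ht'⟩ := mem_run.1 hb
  have hs2 := step_some_some.1 hs
  have ht2 := step_some_some.1 ht
  have hcomp : p.take q.length = q.take p.length := by
    rw [List.take_of_length_le hpq.length_le]
    exact List.prefix_iff_eq_take.1 hpq
  rcases lt_trichotomy s t with h | h | h
  · have := (step_isSome (c := c) (y := q) (s := s)).2 ⟨p, hs2.1, a, hs2.2, hcomp, rfl⟩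
    rw [ht' s h] at this
    cases this
  · subst h
    exact Option.some_injective _ (hs2.1.symm.trans ht2.1)
  · have := (step_isSome (c := c) (y := p) (s := t)).2 ⟨q, ht2.1, b, ht2.2, hcomp.symm, rfl⟩
    rw [hs' t h] at this
    cases this

theorem run_eq {T : List Bool →. ℕ} (hT : IsPrefixMachine T) {c : Code}
    (hc : ∀ y, c.eval (encode y) = T y) {y : List Bool} {a : ℕ} (ha : a ∈ T y) :
    a ∈ run c y := by
  have hex : ∃ s, ∃ o, step c y s = some o := by
    rw [← hc] at ha
    obtain ⟨k, hk⟩ := Code.evaln_complete.1 ha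
    exact ⟨Nat.pair (encode y) k, some a, step_some_some.2 (by simpa using hk)⟩
  classical
  obtain ⟨o, ho⟩ := Nat.find_spec hex
  refine mem_run.2 ⟨Nat.find hex, ?_, fun t ht => ?_⟩
  · obtain ⟨z, hz, v, hv, hcomp, hif⟩ := step_isSome.1 ho
    have hvT : v ∈ T z := by
      rw [← hc]
      exact Code.evaln_sound hv
    have hzy : z = y := by
      have hzd : (T z).Dom := Part.dom_iff_mem.2 ⟨v, hvT⟩
      have hyd : (T y).Dom := Part.dom_iff_mem.2 ⟨a, ha⟩
      rcases le_total z.length y.length with hl | hl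
      · rw [List.take_of_length_le hl] at hcomp
        exact hT.prefixFree z y hzd hyd (List.prefix_iff_eq_take.2 hcomp)
      · rw [List.take_of_length_le hl] at hcomp
        exact (hT.prefixFree y z hyd hzd (List.prefix_iff_eq_take.2 hcomp.symm)).symm
    subst hzy
    have hva : v = a := Part.mem_unique hvT ha
    subst hva
    simp only [if_true] at hif
    rw [ho, hif]
  · have := Nat.find_min hex ht
    push Not at this
    exact Option.eq_none_iff_forall_ne_some.2 this

theorem mem_machine {p : List Bool} {a : ℕ} : a ∈ machine p ↔ p.idxOf false < p.length ∧
    a ∈ run (Denumerable.ofNat Code (p.idxOf false)) (p.drop (p.idxOf false + 1)) := by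
  unfold machine
  rw [Part.mem_bind_iff]
  by_cases h : p.idxOf false < p.length <;> simp [h]

theorem isUniversalPrefixMachine_machine : IsUniversalPrefixMachine machine := by
  refine ⟨⟨machine_partrec, fun p q hp hq hpq => ?_⟩, fun T hT => ?_⟩
  · obtain ⟨a, ha⟩ := Part.dom_iff_mem.1 hp
    obtain ⟨b, hb⟩ := Part.dom_iff_mem.1 hq
    obtain ⟨hlp, ha⟩ := mem_machine.1 ha
    obtain ⟨hlq, hb⟩ := mem_machine.1 hb
    obtain ⟨r, rfl⟩ := hpq
    have hmem : false ∈ p := List.idxOf_lt_length_iff.1 hlp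
    have hi : (p ++ r).idxOf false = p.idxOf false := List.idxOf_append_of_mem hmem
    rw [hi] at hb
    rw [List.drop_append_of_le_length hlp] at hb
    have := run_prefixFree _ _ _ (Part.dom_iff_mem.2 ⟨a, ha⟩) (Part.dom_iff_mem.2 ⟨b, hb⟩)
      (List.prefix_append _ r)
    have hr : r = [] := by simpa using this
    simp [hr]
  · obtain ⟨c, hc⟩ := Code.exists_code.1 hT.partrec
    have hc' : ∀ y, c.eval (encode y) = T y := fun y => by
      rw [hc]
      simp only [encodek, Part.coe_some, Part.bind_some]
      exact Part.map_id' (fun _ => rfl) _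
    refine ⟨encode c + 1, fun y a ha =>
      ⟨List.replicate (encode c) true ++ false :: y, mem_machine.2 ?_, by simp; omega⟩⟩
    have hidx : (List.replicate (encode c) true ++ false :: y).idxOf false = encode c := by
      rw [List.idxOf_append_of_notMem (by simp)]
      simp
    have hdrop : (List.replicate (encode c) true ++ false :: y).drop (encode c + 1) = y := by
      rw [List.drop_append]
      simp
    rw [hidx, hdrop, Denumerable.ofNat_encode]
    exact ⟨by simp, run_eq hT hc' ha⟩

end UniversalMachineConstruction

/-- There is a universal prefix machine. -/
theorem exists_isUniversalPrefixMachine : ∃ U : List Bool →. ℕ, IsUniversalPrefixMachine U :=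
  ⟨_, UniversalMachineConstruction.isUniversalPrefixMachine_machine⟩

/-! ### Sequential information sources -/

/-- A sequential information source over `{0,1}`: `mass x` is the probability that the infinite
sequence starts with `x`. -/
structure SequentialSource where
  mass : List Bool → ℝ
  mass_nonneg : ∀ x, 0 ≤ mass x
  mass_nil : mass [] = 1
  mass_append : ∀ x, mass (x ++ [false]) + mass (x ++ [true]) = mass x

namespace SequentialSource

/-- The marginal mass function `f⁽ⁿ⁾` on `{0,1}ⁿ`. -/
def marginal (f : SequentialSource) (n : ℕ) (x : List.Vector Bool n) : ℝ :=
  f.mass x.toList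

open Classical in
/-- The conditional mass function `f⁽ⁿ⁾(x | s)` given the value `s` of the statistic `S`. -/
noncomputable def condMass (f : SequentialSource) (S : List Bool → Set (List Bool)) (n : ℕ)
    (x : List.Vector Bool n) (s : Set (List Bool)) : ℝ :=
  if S x.toList = s then
    f.marginal n x / ∑ y : List.Vector Bool n with S y.toList = s, f.marginal n y
  else 0

/-- `K(f)` for a source `f ≡ (f⁽¹⁾, f⁽²⁾, …)`, viewed as a real-valued function on strings. -/
noncomputable def complexity (U : List Bool →. ℕ) (f : SequentialSource) : ℕ∞ :=
  KolmogorovComplexity.ofFun U f.mass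

end SequentialSource

/-! ### Sequential statistics and sufficiency -/

/-- The collection `C` is a partition of the set `A` into nonempty sets. -/
structure IsPartitionOf {α : Type*} (C : Set (Set α)) (A : Set α) : Prop where
  nonempty : ∀ s ∈ C, s.Nonempty
  disjoint : C.PairwiseDisjoint id
  sUnion_eq : ⋃₀ C = A

/-- A sequential statistic. -/
structure IsSequentialStatistic (S : List Bool → Set (List Bool)) : Prop where
  subset : ∀ x, S x ⊆ {y | y.length = x.length}
  mem_self : ∀ x, x ∈ S x
  partition : ∀ n : ℕ, IsPartitionOf (S '' {x | x.length = n}) {x | x.length = n}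

open scoped ENNReal NNReal in
/-- `S` is sufficient in the algorithmic sense: `K(S(x)) + log |S(x)| ≤ K(x) + c` for all `x`. -/
def IsAlgorithmicallySufficient (U : List Bool →. ℕ) (S : List Bool → Set (List Bool)) : Prop :=
  ∃ c : ℝ≥0, ∀ x : List Bool,
    (KolmogorovComplexity.ofSet U (S x) : ℝ≥0∞) + ENNReal.ofReal (Real.logb 2 (S x).ncard) ≤
      (KolmogorovComplexity.ofString U x : ℝ≥0∞) + (c : ℝ≥0∞)

/-- The inequality
`|∑ₓ f⁽ⁿ⁾(x) [log 1/f⁽ⁿ⁾(x | S(x)) - log 1/g⁽ⁿ⁾(x | S(x))]| ≤ c`, for one `n`.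
Terms with `f⁽ⁿ⁾(x) = 0` vanish; the positivity clause says that the sum is finite
(recall `log 1/0 = ∞`). -/
def ExpectedSufficiencyBound (f : SequentialSource) (S : List Bool → Set (List Bool))
    (g : ∀ n : ℕ, List.Vector Bool n → Set (List Bool) → ℝ) (n : ℕ) (c : ℝ) : Prop :=
  (∀ x : List.Vector Bool n, 0 < f.marginal n x → 0 < g n x (S x.toList)) ∧
  |∑ x : List.Vector Bool n, f.marginal n x *
    (Real.logb 2 (1 / f.condMass S n x (S x.toList)) -
      Real.logb 2 (1 / g n x (S x.toList)))| ≤ c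

/-- `S` is nearly sufficient for `{f_θ}` in the probabilistic-expectation sense, with the functions
`g⁽ⁿ⁾` as witnesses. -/
def NearlySufficientWith {Θ : Type*} (f : Θ → SequentialSource) (S : List Bool → Set (List Bool))
    (g : ∀ n : ℕ, List.Vector Bool n → Set (List Bool) → ℝ) : Prop :=
  ∃ c : ℝ, ∀ (θ : Θ) (n : ℕ), ExpectedSufficiencyBound (f θ) S g n c

/-- `S` is nearly sufficient for `{f_θ}` in the probabilistic-expectation sense. -/
def NearlySufficient {Θ : Type*} (f : Θ → SequentialSource) (S : List Bool → Set (List Bool)) :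
    Prop :=
  ∃ g : ∀ n : ℕ, List.Vector Bool n → Set (List Bool) → ℝ, NearlySufficientWith f S g

open Classical in
/-- The conditional mass function arising from the uniform distribution on `{0,1}ⁿ`. -/
noncomputable def uniformCond (S : List Bool → Set (List Bool)) (n : ℕ)
    (x : List.Vector Bool n) (s : Set (List Bool)) : ℝ :=
  if S x.toList = s then
    1 / ((Finset.univ.filter fun y : List.Vector Bool n => S y.toList = s).card : ℝ)
  else 0

/-! The sum in question is the expectation of log(F/f(x)) - log N, where N is the size of the block
of x and F is its mass.

It is at most 0 by Gibbs' inequality inside the blocks: log t ≤ t - 1 in each term, then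
`sum_mul_blockSum_div_le`.

The lower bound comes from coding. Fix a program i computing f. A prefix machine with i built in
reads a shortest program p for a listing of S(x), then a codeword q for x in a prefix-free code
adapted to the restriction of f to the listing. As f is only known approximately, the code uses
integer weights between 2ⁿf(z) and 2ⁿf(z) + 3, and |q| ≤ 2 + log((2ⁿF + 3N)/(2ⁿf(x))) when f(x) > 0
(`exists_decodeWord_eq`, `exists_weight`). Hence K(x) ≤ K(S(x)) + |q| + O(1). Algorithmic
sufficiency cancels K(S(x)) and leaves log N ≤ |q| + O(1) (`exists_logb_ncard_le`).

Rounding costs log(1 + 3N/(2ⁿF)), which need not be bounded pointwise. Its expectation is, because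
the f-average of N/F is the number of strings in blocks of positive mass, at most 2ⁿ
(`neg_le_sum_mul_logb_sub_logb_card`).

The constant depends on f only through i. If K(f_θ) is bounded, finitely many i suffice, and the
largest of their constants serves all θ. -/

/-! ### Decoding a word to the block of a list that contains its dyadic interval -/

namespace BlockCode

variable {α : Type*}

/-- The number with binary expansion `q`, most significant digit first. -/
def value (q : List Bool) : ℕ :=
  q.foldl (fun v b => 2 * v + b.toNat) 0

theorem value_concat (q : List Bool) (b : Bool) : value (q ++ [b]) = 2 * value q + b.toNat := by
  simp [value]

theorem value_append (q r : List Bool) :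
    value (q ++ r) = value q * 2 ^ r.length + value r := by
  induction r using List.reverseRecOn with
  | nil => simp [value]
  | append_singleton r b ih =>
    rw [← List.append_assoc, value_concat, value_concat, ih]
    simp only [List.length_append, List.length_singleton, pow_succ]
    ring

theorem value_lt (q : List Bool) : value q < 2 ^ q.length := by
  induction q using List.reverseRecOn with
  | nil => simp [value]
  | append_singleton q b ih =>
    rw [value_concat, List.length_append, List.length_singleton, pow_succ]
    have := Bool.toNat_le b
    omega

theorem exists_value_eq {m v : ℕ} (h : v < 2 ^ m) :
    ∃ q : List Bool, q.length = m ∧ value q = v := by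
  induction m generalizing v with
  | zero => exact ⟨[], rfl, by simp [value]; omega⟩
  | succ m ih =>
    obtain ⟨q, hq, hv⟩ := ih (v := v / 2) (by rw [pow_succ] at h; omega)
    refine ⟨q ++ [v.bodd], by simp [hq], ?_⟩
    rw [value_concat, hv]
    have := Nat.mod_two_of_bodd v
    cases hb : v.bodd <;> simp [hb] at this ⊢ <;> omega

/-- The index of the entry of `L` at the left end of the dyadic interval of `q`, when the `i`-th
entry is placed on `[i / |L|, (i + 1) / |L|)`. -/
def position (L : List α) (q : List Bool) : ℕ :=
  value q * L.length / 2 ^ q.length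

/-- The list `L` is constant on the dyadic interval of `q`. -/
def IsConstantOn (L : List α) (q : List Bool) : Prop :=
  -- The strict inequalities are cleared of denominators: they say that [i/|L|, (i+1)/|L|) overlaps
  -- the dyadic interval in positive length.
  ∀ i < L.length, i * 2 ^ q.length < (value q + 1) * L.length →
    value q * L.length < (i + 1) * 2 ^ q.length → L[i]? = L[position L q]?

instance [DecidableEq α] (L : List α) (q : List Bool) : Decidable (IsConstantOn L q) := by
  unfold IsConstantOn
  infer_instance

/-- A word is decoded if it is minimal among the words on whose dyadic interval `L` is constant. -/
def decodeWord [DecidableEq α] (L : List α) (q : List Bool) : Option α :=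
  if IsConstantOn L q ∧ ∀ j < q.length, ¬ IsConstantOn L (q.take j) then L[position L q]? else none

theorem position_lt {L : List α} (hL : L ≠ []) (q : List Bool) : position L q < L.length := by
  rw [position, Nat.div_lt_iff_lt_mul (by positivity), mul_comm]
  exact Nat.mul_lt_mul_of_pos_left (value_lt q) (List.length_pos_of_ne_nil hL)

/-- Extending a word shrinks its dyadic interval, so the entry at the new left end still meets the
old interval. Truncating a word to a prefix of constancy therefore does not change what it selects.
-/
theorem IsConstantOn.getElem?_position {L : List α} {q r : List Bool} (h : IsConstantOn L q)
    (hqr : q <+: r) (hL : L ≠ []) : L[position L r]? = L[position L q]? := by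
  obtain ⟨r, rfl⟩ := hqr
  have hW := List.length_pos_of_ne_nil hL
  have hpos := position_lt hL (q ++ r)
  have h1 : position L (q ++ r) * 2 ^ (q ++ r).length ≤ value (q ++ r) * L.length :=
    Nat.div_mul_le_self _ _
  have h2 : value (q ++ r) * L.length < (position L (q ++ r) + 1) * 2 ^ (q ++ r).length :=
    (Nat.div_lt_iff_lt_mul (by positivity)).1 (Nat.lt_succ_self _)
  rw [value_append, List.length_append, pow_add] at h1 h2
  have hr := value_lt r
  have h3 := Nat.mul_lt_mul_of_pos_right hr hW
  have hp : 0 < 2 ^ r.length := by positivity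
  refine h _ hpos ?_ ?_ <;> refine lt_of_mul_lt_mul_right (a := 2 ^ r.length) ?_ hp.le
  · nlinarith
  · nlinarith [Nat.zero_le (value r * L.length)]

/-- Minimality makes the code prefix-free: a decoded proper prefix of q would be a shorter prefix of
constancy. -/
theorem decodeWord_eq_of_prefix [DecidableEq α] {L : List α} {p q : List Bool} {a b : α}
    (hp : decodeWord L p = some a) (hq : decodeWord L q = some b) (h : p <+: q) : p = q := by
  unfold decodeWord at hp hq
  split_ifs at hp hq with h1 h2
  rcases h.length_le.lt_or_eq with hlt | heq
  · rw [List.prefix_iff_eq_take.1 h] at h1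
    exact absurd h1.1 (h2.2 _ hlt)
  · exact h.eq_of_length heq

theorem IsConstantOn.exists_decodeWord [DecidableEq α] {L : List α} {q : List Bool} {a : α}
    (h : IsConstantOn L q) (ha : L[position L q]? = some a) :
    ∃ r, r.length ≤ q.length ∧ decodeWord L r = some a := by
  have hex : ∃ j, IsConstantOn L (q.take j) := ⟨q.length, by simpa using h⟩
  have hle : Nat.find hex ≤ q.length := Nat.find_min' hex (by simpa using h)
  refine ⟨q.take (Nat.find hex), by simp, ?_⟩
  have hL : L ≠ [] := by rintro rfl; simp at ha
  rw [decodeWord, if_pos, ← (Nat.find_spec hex).getElem?_position (List.take_prefix _ _) hL, ha]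
  refine ⟨Nat.find_spec hex, fun j hj => ?_⟩
  rw [List.length_take, min_eq_left hle] at hj
  rw [List.take_take, min_eq_left hj.le]
  exact Nat.find_min hex hj

/-- A block of length `w` in a list of length `W` has a codeword of length about `log (W / w)`. -/
theorem exists_decodeWord_eq [DecidableEq α] (A B : List α) (w : ℕ) (hw : 0 < w) (x : α) :
    ∃ q : List Bool, 2 ^ q.length * w ≤ 4 * (A ++ List.replicate w x ++ B).length ∧
      decodeWord (A ++ List.replicate w x ++ B) q = some x := by
  set L := A ++ List.replicate w x ++ B with hLdef
  have hlen : L.length = A.length + w + B.length := by simp [hLdef, add_assoc]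
  have hget : ∀ i, A.length ≤ i → i < A.length + w → L[i]? = some x := by
    intro i h1 h2
    rw [hLdef, List.append_assoc, List.getElem?_append_right h1, List.getElem?_append_left
      (by simp; omega), List.getElem?_replicate, if_pos (by omega)]
  have hex : ∃ m, 2 * L.length ≤ 2 ^ m * w :=
    ⟨2 * L.length, (Nat.lt_two_pow_self).le.trans (Nat.le_mul_of_pos_right _ hw)⟩
  -- The least m for which a dyadic interval of length 2⁻ᵐ fills at most half of the block;
  -- leastness costs only the factor 4.
  obtain ⟨m, hm, hmin⟩ : ∃ m, 2 * L.length ≤ 2 ^ m * w ∧ 2 ^ m * w ≤ 4 * L.length := by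
    refine ⟨Nat.find hex, Nat.find_spec hex, ?_⟩
    rcases h0 : Nat.find hex with _ | m
    · simp; omega
    · have := Nat.find_min hex (m := m) (by omega)
      rw [pow_succ]
      nlinarith
  have hW : 0 < L.length := by omega
  -- v is 2ᵐ|A|/|L| rounded up: the first dyadic point not to the left of the block. Since the block
  -- has length at least two steps, the interval starting there stays inside it.
  obtain ⟨v, hv1, hv2⟩ : ∃ v, 2 ^ m * A.length ≤ v * L.length ∧
      v * L.length < 2 ^ m * A.length + L.length := by
    refine ⟨(2 ^ m * A.length + L.length - 1) / L.length, ?_, ?_⟩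
    · have h1 := Nat.div_add_mod (2 ^ m * A.length + L.length - 1) L.length
      have h2 := Nat.mod_lt (2 ^ m * A.length + L.length - 1) hW
      rw [mul_comm _ L.length]
      omega
    · have := Nat.div_mul_le_self (2 ^ m * A.length + L.length - 1) L.length
      omega
  have hv3 : (v + 1) * L.length ≤ 2 ^ m * (A.length + w) := by
    rw [add_mul, mul_add]
    omega
  have hv : v < 2 ^ m := by
    have : (v + 1) * L.length ≤ 2 ^ m * L.length :=
      hv3.trans (Nat.mul_le_mul_left _ (by omega))
    exact Nat.le_of_mul_le_mul_right this hW
  obtain ⟨q, rfl, rfl⟩ := exists_value_eq hv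
  have hp1 : A.length ≤ position L q := by
    rw [position, Nat.le_div_iff_mul_le (by positivity), mul_comm]
    exact hv1
  have hp2 : position L q < A.length + w := by
    rw [position, Nat.div_lt_iff_lt_mul (by positivity), mul_comm (A.length + w)]
    refine lt_of_lt_of_le ?_ hv3
    rw [add_mul]
    omega
  have hc : IsConstantOn L q := by
    intro i hi h1 h2
    rw [hget _ hp1 hp2, hget i]
    · have := lt_of_le_of_lt hv1 h2
      rw [mul_comm (i + 1)] at this
      have := Nat.lt_of_mul_lt_mul_left this
      omega
    · have := lt_of_lt_of_le h1 hv3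
      rw [mul_comm] at this
      exact Nat.lt_of_mul_lt_mul_left this
  obtain ⟨r, hr, hrx⟩ := hc.exists_decodeWord (hget _ hp1 hp2)
  exact ⟨r, (Nat.mul_le_mul_right _ (Nat.pow_le_pow_right (by norm_num) hr)).trans hmin, hrx⟩

/-! ### Primitive recursiveness of the decoder -/

theorem primrec_two_pow : Primrec fun n : ℕ => 2 ^ n := by
  refine (Primrec.nat_rec₁ (f := fun _ v => 2 * v) 1
    (Primrec.nat_double.comp Primrec.snd).to₂).of_eq fun n => ?_
  induction n with
  | zero => rfl
  | succ n ih => simp only [pow_succ', ← ih]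

theorem primrec_value : Primrec value := by
  refine Primrec.list_foldl (h := fun _ (p : ℕ × Bool) => 2 * p.1 + p.2.toNat) Primrec.id (Primrec.const 0) ?_
  have h : Primrec Bool.toNat := Primrec.dom_finite _
  exact (Primrec.nat_add.comp (Primrec.nat_double.comp (Primrec.fst.comp Primrec.snd))
    (h.comp (Primrec.snd.comp Primrec.snd))).to₂

variable [Primcodable α]

theorem primrec_position : Primrec₂ (position : List α → List Bool → ℕ) :=
  (Primrec.nat_div.comp
    (Primrec.nat_mul.comp (primrec_value.comp Primrec.snd) (Primrec.list_length.comp Primrec.fst))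
    (primrec_two_pow.comp (Primrec.list_length.comp Primrec.snd))).to₂

theorem primrecPred_isConstantOn [DecidableEq α] :
    PrimrecPred fun a : List α × List Bool => IsConstantOn a.1 a.2 := by
  have hL : Primrec fun a : ℕ × (List α × List Bool) => a.2.1.length :=
    Primrec.list_length.comp (Primrec.fst.comp Primrec.snd)
  have hv : Primrec fun a : ℕ × (List α × List Bool) => value a.2.2 :=
    primrec_value.comp (Primrec.snd.comp Primrec.snd)
  have hp : Primrec fun a : ℕ × (List α × List Bool) => 2 ^ a.2.2.length :=
    primrec_two_pow.comp (Primrec.list_length.comp (Primrec.snd.comp Primrec.snd))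
  have hg : Primrec fun a : ℕ × (List α × List Bool) => a.2.1[a.1]? :=
    Primrec.list_getElem?.comp (Primrec.fst.comp Primrec.snd) Primrec.fst
  have hg' : Primrec fun a : ℕ × (List α × List Bool) => a.2.1[position a.2.1 a.2.2]? :=
    Primrec.list_getElem?.comp (Primrec.fst.comp Primrec.snd) 
      (primrec_position.comp (Primrec.fst.comp Primrec.snd) (Primrec.snd.comp Primrec.snd))
  have h1 : PrimrecPred fun a : ℕ × (List α × List Bool) =>
      a.1 * 2 ^ a.2.2.length < (value a.2.2 + 1) * a.2.1.length :=
    Primrec.nat_lt.comp (Primrec.nat_mul.comp Primrec.fst hp)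
      (Primrec.nat_mul.comp (Primrec.succ.comp hv) hL)
  have h2 : PrimrecPred fun a : ℕ × (List α × List Bool) =>
      value a.2.2 * a.2.1.length < (a.1 + 1) * 2 ^ a.2.2.length :=
    Primrec.nat_lt.comp (Primrec.nat_mul.comp hv hL)
      (Primrec.nat_mul.comp (Primrec.succ.comp Primrec.fst) hp)
  have h3 : PrimrecPred fun a : ℕ × (List α × List Bool) =>
      a.2.1[a.1]? = a.2.1[position a.2.1 a.2.2]? := Primrec.eq.comp hg hg'
  have h : PrimrecRel fun (i : ℕ) (a : List α × List Bool) =>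
      ¬ (i * 2 ^ a.2.length < (value a.2 + 1) * a.1.length) ∨
      ¬ (value a.2 * a.1.length < (i + 1) * 2 ^ a.2.length) ∨ a.1[i]? = a.1[position a.1 a.2]? :=
    h1.not.or (h2.not.or h3)
  refine (h.forall_mem_list.comp (Primrec.list_range.comp (Primrec.list_length.comp Primrec.fst))
    Primrec.id).of_eq fun a => ?_
  simp only [IsConstantOn, id, imp_iff_not_or, List.mem_range]

theorem primrec_decodeWord [DecidableEq α] :
    Primrec fun a : List α × List Bool => decodeWord a.1 a.2 := by
  have h : PrimrecRel fun (j : ℕ) (a : List α × List Bool) =>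
      ¬ IsConstantOn a.1 (a.2.take j) :=
    (primrecPred_isConstantOn.comp ((Primrec.fst.comp Primrec.snd).pair
      (Primrec.list_take.comp Primrec.fst (Primrec.snd.comp Primrec.snd)))).not
  have h' : PrimrecPred fun a : List α × List Bool =>
      ∀ j < a.2.length, ¬ IsConstantOn a.1 (a.2.take j) :=
    (h.forall_mem_list.comp (Primrec.list_range.comp (Primrec.list_length.comp Primrec.snd))
      Primrec.id).of_eq fun a => by simp only [id, List.mem_range]
  exact Primrec.ite (primrecPred_isConstantOn.and h')
    (Primrec.list_getElem?.comp Primrec.fst primrec_position) (Primrec.const none)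

end BlockCode

/-! ### Describing an element of a list relative to a computable function -/

namespace ElementMachine

open Encodable BlockCode
open Nat.Partrec (Code)

/-- The integer weight `⌊2ⁿ p / q⌋ + 2` of a string of length `n`, for `r = ⟨p, q⟩`. -/
def weight (r : ℕ) (x : List Bool) : ℕ :=
  -- The summand 2 offsets the approximation error and the floor, each below 1 after scaling by 2ⁿ.
  -- It also gives strings of mass 0 a positive weight, hence a codeword.
  2 ^ x.length * r.unpair.1 / r.unpair.2 + 2

/-- The list `l` with each entry repeated according to its weight, where the approximate values
are computed by `c` within `t` steps. -/
def expand (c : Code) (t : ℕ) (l : List (List Bool)) : Option (List (List Bool)) :=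
  l.foldr (fun x acc => acc.bind fun L =>
    (Code.evaln t c (Nat.pair (encode x) (2 ^ x.length))).map fun r =>
      List.replicate (weight r x) x ++ L) (some [])

/-- Stage `s = ⟨k, t⟩` of the search: the first `k` digits of `y` are run on `u` to obtain a list of
strings, one of whose entries is selected by the remaining digits. -/
def step (u c : Code) (y : List Bool) (s : ℕ) : Option ℕ :=
  -- The end of the list program is not marked, so the cut k is searched for; as `U` is prefix-free,
  -- at most one cut can succeed.
  (Code.evaln s.unpair.2 u (encode (y.take s.unpair.1))).bind fun e =>
    (decode (α := List (List Bool)) e).bind fun l =>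
      (expand c s.unpair.2 l).bind fun L =>
        (decodeWord L (y.drop s.unpair.1)).map encode

/-- The machine that maps a program for a list of strings, followed by a codeword of one of the
entries, to this entry. -/
def machine (u c : Code) (y : List Bool) : Part ℕ :=
  Nat.rfindOpt (step u c y)

/-! ### Computability of the element machine -/

theorem primrec_weight : Primrec₂ weight :=
  (Primrec.nat_add.comp
    (Primrec.nat_div.comp
      (Primrec.nat_mul.comp
        (primrec_two_pow.comp (Primrec.list_length.comp Primrec.snd))
        (Primrec.fst.comp (Primrec.unpair.comp Primrec.fst)))
      (Primrec.snd.comp (Primrec.unpair.comp Primrec.fst)))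
    (Primrec.const 2)).to₂

theorem primrec_replicate {α : Type*} [Primcodable α] :
    Primrec fun a : ℕ × α => List.replicate a.1 a.2 :=
  (Primrec.list_map (f := fun a : ℕ × α => List.range a.1) (g := fun a _ => a.2)
    (Primrec.list_range.comp Primrec.fst) (Primrec.snd.comp Primrec.fst).to₂).of_eq
      fun a => by simp [List.map_const']

theorem primrec_expand (c : Code) :
    Primrec fun a : ℕ × List (List Bool) => expand c a.1 a.2 := by
  unfold expand
  refine Primrec.list_foldr (h := fun (a : ℕ × List (List Bool))
    (p : List Bool × Option (List (List Bool))) => p.2.bind fun L =>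
      (Code.evaln a.1 c (Nat.pair (encode p.1) (2 ^ p.1.length))).map fun r =>
        List.replicate (weight r p.1) p.1 ++ L) Primrec.snd (Primrec.const _) ?_
  have hx : Primrec fun b : ((ℕ × List (List Bool)) × List Bool × Option (List (List Bool))) ×
      List (List Bool) => b.1.2.1 := Primrec.fst.comp (Primrec.snd.comp Primrec.fst)
  refine Primrec.option_bind (f := fun b : (ℕ × List (List Bool)) × List Bool ×
    Option (List (List Bool)) => b.2.2) (Primrec.snd.comp Primrec.snd) ?_
  refine Primrec.option_map (f := fun b : ((ℕ × List (List Bool)) × List Bool ×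
    Option (List (List Bool))) × List (List Bool) =>
      Code.evaln b.1.1.1 c (Nat.pair (encode b.1.2.1) (2 ^ b.1.2.1.length))) ?_ ?_
  · exact Code.primrec_evaln.comp
      (((Primrec.fst.comp (Primrec.fst.comp Primrec.fst)).pair (Primrec.const c)).pair
        (Primrec₂.natPair.comp (Primrec.encode.comp hx)
          (primrec_two_pow.comp (Primrec.list_length.comp hx))))
  · exact Primrec.list_append.comp
      (primrec_replicate.comp ((primrec_weight.comp Primrec.snd (hx.comp Primrec.fst)).pair
        (hx.comp Primrec.fst))) (Primrec.snd.comp Primrec.fst)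

theorem primrec_step (u c : Code) : Primrec fun a : List Bool × ℕ => step u c a.1 a.2 := by
  unfold step
  have hk : Primrec fun a : List Bool × ℕ => a.2.unpair.1 :=
    Primrec.fst.comp (Primrec.unpair.comp Primrec.snd)
  have ht : Primrec fun a : List Bool × ℕ => a.2.unpair.2 :=
    Primrec.snd.comp (Primrec.unpair.comp Primrec.snd)
  refine Primrec.option_bind (Code.primrec_evaln.comp ((ht.pair (Primrec.const u)).pair
    (Primrec.encode.comp (Primrec.list_take.comp hk Primrec.fst)))) ?_
  refine Primrec.option_bind (f := fun b : (List Bool × ℕ) × ℕ =>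
    (decode b.2 : Option (List (List Bool)))) (Primrec.decode.comp Primrec.snd) ?_
  refine Primrec.option_bind (f := fun b : ((List Bool × ℕ) × ℕ) × List (List Bool) =>
    expand c b.1.1.2.unpair.2 b.2) ((primrec_expand c).comp
      ((ht.comp (Primrec.fst.comp Primrec.fst)).pair Primrec.snd)) ?_
  refine Primrec.option_map (f := fun b : (((List Bool × ℕ) × ℕ) × List (List Bool)) ×
    List (List Bool) => decodeWord b.2 (b.1.1.1.1.drop b.1.1.1.2.unpair.1)) ?_
      (Primrec.encode.comp Primrec.snd)
  have ha : Primrec fun b : (((List Bool × ℕ) × ℕ) × List (List Bool)) × List (List Bool) =>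
      b.1.1.1 := Primrec.fst.comp (Primrec.fst.comp Primrec.fst)
  exact primrec_decodeWord.comp (Primrec.snd.pair
    (Primrec.list_drop.comp (hk.comp ha) (Primrec.fst.comp ha)))

theorem partrec_machine (u c : Code) : Partrec (machine u c) :=
  Partrec.rfindOpt (f := step u c) (primrec_step u c).to_comp

/-! ### Correctness of the element machine -/

theorem expand_cons {c : Code} {t : ℕ} {x : List Bool} {l L : List (List Bool)} :
    expand c t (x :: l) = some L ↔ ∃ L', expand c t l = some L' ∧
      ∃ r, Code.evaln t c (Nat.pair (encode x) (2 ^ x.length)) = some r ∧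
        List.replicate (weight r x) x ++ L' = L := by
  simp [expand, Option.bind_eq_some_iff]

theorem expand_mono {c : Code} {t t' : ℕ} (h : t ≤ t') {l L : List (List Bool)}
    (hL : expand c t l = some L) : expand c t' l = some L := by
  induction l generalizing L with
  | nil => simpa [expand] using hL
  | cons x l ih =>
    obtain ⟨L', hL', r, hr, rfl⟩ := expand_cons.1 hL
    exact expand_cons.2 ⟨L', ih hL', r, Code.evaln_mono h hr, rfl⟩

/-- The time bound decides only whether the expansion is finished, not its value, so all stages
share one codebook. -/
theorem expand_unique {c : Code} {t t' : ℕ} {l L L' : List (List Bool)}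
    (hL : expand c t l = some L) (hL' : expand c t' l = some L') : L = L' :=
  Option.some_injective _ ((expand_mono (le_max_left t t') hL).symm.trans
    (expand_mono (le_max_right t t') hL'))

theorem exists_expand_eq {c : Code} {r : List Bool → ℕ} {l : List (List Bool)}
    (h : ∀ x ∈ l, r x ∈ c.eval (Nat.pair (encode x) (2 ^ x.length))) :
    ∃ t, expand c t l = some (l.flatMap fun x => List.replicate (weight (r x) x) x) := by
  induction l with
  | nil => exact ⟨0, rfl⟩
  | cons x l ih =>
    obtain ⟨t, ht⟩ := ih fun z hz => h z (List.mem_cons_of_mem _ hz)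
    obtain ⟨t', ht'⟩ := Code.evaln_complete.1 (h x List.mem_cons_self)
    exact ⟨max t t', expand_cons.2 ⟨_, expand_mono (le_max_left _ _) ht, _,
      Code.evaln_mono (le_max_right _ _) ht', rfl⟩⟩

theorem step_eq_some {u c : Code} {y : List Bool} {s a : ℕ} : step u c y s = some a ↔
    ∃ e, Code.evaln s.unpair.2 u (encode (y.take s.unpair.1)) = some e ∧
      ∃ l : List (List Bool), decode e = some l ∧ ∃ L, expand c s.unpair.2 l = some L ∧
        ∃ x, decodeWord L (y.drop s.unpair.1) = some x ∧ encode x = a := by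
  simp [step, Option.bind_eq_some_iff]

variable {U : List Bool →. ℕ} {u : Code}

/-- Both list programs are prefixes of z on which `U` halts, so they coincide. They yield the same
list and the same codebook, and the remaining digits are comparable words of one prefix-free code.
-/
theorem eq_of_step_of_prefix (hU : IsPrefixMachine U) (hu : ∀ y, u.eval (encode y) = U y)
    {c : Code} {y z : List Bool} (hyz : y <+: z) {s t a b : ℕ} (hs : step u c y s = some a)
    (ht : step u c z t = some b) : y = z := by
  obtain ⟨e, he, l, hl, L, hL, x, hx, -⟩ := step_eq_some.1 hs
  obtain ⟨e', he', l', hl', L', hL', x', hx', -⟩ := step_eq_some.1 ht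
  have heU : e ∈ U (y.take s.unpair.1) := hu _ ▸ Code.evaln_sound he
  have heU' : e' ∈ U (z.take t.unpair.1) := hu _ ▸ Code.evaln_sound he'
  have hpre : y.take s.unpair.1 = z.take t.unpair.1 := by
    rcases List.prefix_or_prefix_of_prefix ((List.take_prefix s.unpair.1 y).trans hyz)
      (List.take_prefix t.unpair.1 z) with h | h
    · exact hU.prefixFree _ _ (Part.dom_iff_mem.2 ⟨_, heU⟩) (Part.dom_iff_mem.2 ⟨_, heU'⟩) h
    · exact (hU.prefixFree _ _ (Part.dom_iff_mem.2 ⟨_, heU'⟩)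
        (Part.dom_iff_mem.2 ⟨_, heU⟩) h).symm
  rw [hpre] at heU
  obtain rfl := Part.mem_unique heU heU'
  obtain rfl := Option.some_injective _ (hl.symm.trans hl')
  obtain rfl := expand_unique hL hL'
  rw [← List.take_append_drop s.unpair.1 y, ← List.take_append_drop t.unpair.1 z, hpre] at hyz
  rw [← List.take_append_drop s.unpair.1 y, ← List.take_append_drop t.unpair.1 z, hpre,
    decodeWord_eq_of_prefix hx hx' ((List.prefix_append_right_inj _).1 hyz)]

/-- The search returns its first success; this shows that any other success would give the same
output. -/
theorem step_unique (hU : IsPrefixMachine U) (hu : ∀ y, u.eval (encode y) = U y)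
    {c : Code} {y : List Bool} {s t a b : ℕ} (hs : step u c y s = some a)
    (ht : step u c y t = some b) : a = b := by
  obtain ⟨e, he, l, hl, L, hL, x, hx, rfl⟩ := step_eq_some.1 hs
  obtain ⟨e', he', l', hl', L', hL', x', hx', rfl⟩ := step_eq_some.1 ht
  have heU : e ∈ U (y.take s.unpair.1) := hu _ ▸ Code.evaln_sound he
  have heU' : e' ∈ U (y.take t.unpair.1) := hu _ ▸ Code.evaln_sound he'
  have hpre : y.take s.unpair.1 = y.take t.unpair.1 := by
    rcases List.prefix_or_prefix_of_prefix (List.take_prefix s.unpair.1 y)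
      (List.take_prefix t.unpair.1 y) with h | h
    · exact hU.prefixFree _ _ (Part.dom_iff_mem.2 ⟨_, heU⟩) (Part.dom_iff_mem.2 ⟨_, heU'⟩) h
    · exact (hU.prefixFree _ _ (Part.dom_iff_mem.2 ⟨_, heU'⟩)
        (Part.dom_iff_mem.2 ⟨_, heU⟩) h).symm
  have hdrop : y.drop s.unpair.1 = y.drop t.unpair.1 := by
    have := (List.take_append_drop s.unpair.1 y).trans (List.take_append_drop t.unpair.1 y).symm
    rw [hpre] at this
    exact List.append_cancel_left this
  rw [hpre] at heU
  obtain rfl := Part.mem_unique heU heU'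
  obtain rfl := Option.some_injective _ (hl.symm.trans hl')
  obtain rfl := expand_unique hL hL'
  rw [hdrop] at hx
  rw [Option.some_injective _ (hx.symm.trans hx')]

theorem isPrefixMachine_machine (hU : IsPrefixMachine U) (hu : ∀ y, u.eval (encode y) = U y)
    (c : Code) : IsPrefixMachine (machine u c) := by
  refine ⟨partrec_machine u c, fun y z hy hz hyz => ?_⟩
  obtain ⟨s, a, hs⟩ := Nat.rfindOpt_dom.1 hy
  obtain ⟨t, b, ht⟩ := Nat.rfindOpt_dom.1 hz
  exact eq_of_step_of_prefix hU hu hyz hs ht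

theorem mem_machine (hU : IsPrefixMachine U) (hu : ∀ y, u.eval (encode y) = U y)
    {c : Code} {y : List Bool} {s a : ℕ} (hs : step u c y s = some a) : a ∈ machine u c y := by
  obtain ⟨b, hb⟩ := Part.dom_iff_mem.1 (Nat.rfindOpt_dom.2 ⟨s, a, hs⟩)
  obtain ⟨t, ht⟩ := Nat.rfindOpt_spec hb
  rwa [step_unique hU hu hs ht]

/-- If `p` describes the list `l`, an entry `x` is described by `p` followed by about
`log (W / w)` digits, where `w` is the weight of `x` and `W` is the total weight. -/
theorem exists_mem_machine (hU : IsPrefixMachine U) (hu : ∀ y, u.eval (encode y) = U y)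
    {c : Code} {r : List Bool → ℕ} {l : List (List Bool)}
    (hr : ∀ x ∈ l, r x ∈ c.eval (Nat.pair (encode x) (2 ^ x.length)))
    {p : List Bool} (hp : encode l ∈ U p) {x : List Bool} (hx : x ∈ l) :
    ∃ q : List Bool, 2 ^ q.length * weight (r x) x ≤ 4 * (l.map fun z => weight (r z) z).sum ∧
      encode x ∈ machine u c (p ++ q) := by
  -- Splitting the list at x exhibits the copies of x as one contiguous block of the expansion.
  obtain ⟨l₁, l₂, rfl⟩ := List.append_of_mem hx
  obtain ⟨t, ht⟩ := exists_expand_eq hr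
  rw [← hu] at hp
  obtain ⟨t', ht'⟩ := Code.evaln_complete.1 hp
  obtain ⟨q, hq, hqx⟩ := exists_decodeWord_eq
    (l₁.flatMap fun x => List.replicate (weight (r x) x) x)
    (l₂.flatMap fun x => List.replicate (weight (r x) x) x)
    (weight (r x) x) (Nat.succ_pos _) x
  have hstep : step u c (p ++ q) (Nat.pair p.length (max t t')) = some (encode x) := by
    refine step_eq_some.2 ⟨encode (l₁ ++ x :: l₂), ?_, l₁ ++ x :: l₂, encodek _,
      (l₁ ++ x :: l₂).flatMap fun x => List.replicate (weight (r x) x) x, ?_, x, ?_, rfl⟩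
    · simpa using Code.evaln_mono (le_max_right t t') ht'
    · simpa using expand_mono (le_max_left t t') ht
    · simpa using hqx
  refine ⟨q, ?_, mem_machine hU hu hstep⟩
  simpa [List.length_flatMap, add_assoc] using hq

end ElementMachine

/-! ### Expected log-likelihood of a partition -/

section BlockSums

variable {ι κ : Type*} [Fintype ι] [DecidableEq κ]

/-- In each block the sum of a cancels the denominator and leaves the sum of b, or 0 if the
denominator vanishes, since division by 0 gives 0. It is used with (a, b) = (1, f) for the upper
bound and (f, 1) for the lower one. -/
theorem sum_mul_blockSum_div_le (g : ι → κ) {a b : ι → ℝ} (hb : ∀ x, 0 ≤ b x) :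
    ∑ x, a x * ((∑ y with g y = g x, b y) / ∑ y with g y = g x, a y) ≤ ∑ x, b x := by
  have h1 : ∀ x, a x * ((∑ y with g y = g x, b y) / ∑ y with g y = g x, a y) =
      ∑ y, if g y = g x then b y * (a x / ∑ z with g z = g y, a z) else 0 := by
    intro x
    rw [← Finset.sum_filter, Finset.sum_div, Finset.mul_sum]
    refine Finset.sum_congr rfl fun y hy => ?_
    rw [(Finset.mem_filter.1 hy).2]
    ring
  simp_rw [h1]
  rw [Finset.sum_comm]
  refine Finset.sum_le_sum fun y _ => ?_
  have h2 : ∑ x, (if g y = g x then b y * (a x / ∑ z with g z = g y, a z) else 0) =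
      b y * ((∑ z with g z = g y, a z) / ∑ z with g z = g y, a z) := by
    rw [Finset.sum_div, Finset.mul_sum, ← Finset.sum_filter]
    exact Finset.sum_congr (Finset.filter_congr fun x _ => eq_comm) fun _ _ => rfl
  rw [h2]
  exact mul_le_of_le_one_right (hb y) (div_self_le_one _)

variable (g : ι → κ) {f : ι → ℝ}

theorem le_blockSum (hf : ∀ x, 0 ≤ f x) (x : ι) : f x ≤ ∑ y with g y = g x, f y :=
  Finset.single_le_sum (f := f) (fun y _ => hf y) (by simp)

theorem card_block_pos (x : ι) : (0 : ℝ) < (Finset.univ.filter fun y => g y = g x).card :=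
  Nat.cast_pos.2 (Finset.card_pos.2 ⟨x, by simp⟩)

/-- The expected conditional log-likelihood is largest for the uniform distribution. -/
theorem sum_mul_logb_sub_logb_card_nonpos (hf : ∀ x, 0 ≤ f x) (hsum : ∑ x, f x = 1) :
    ∑ x, f x * (Real.logb 2 ((∑ y with g y = g x, f y) / f x) -
      Real.logb 2 (Finset.univ.filter fun y => g y = g x).card) ≤ 0 := by
  have hlog : 0 < Real.log 2 := Real.log_pos (by norm_num)
  -- This is log t ≤ t - 1 at t = F/(f(x)N). The right side is nonnegative when f(x) = 0.
  have hterm : ∀ x, f x * (Real.logb 2 ((∑ y with g y = g x, f y) / f x) -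
      Real.logb 2 (Finset.univ.filter fun y => g y = g x).card) ≤
      ((1 : ℝ) * ((∑ y with g y = g x, f y) / ∑ y with g y = g x, (1 : ℝ)) - f x) /
        Real.log 2 := by
    intro x
    have hN := card_block_pos g x
    have hF := le_blockSum g hf x
    rw [Finset.sum_const, nsmul_eq_mul, mul_one, one_mul]
    generalize ((Finset.univ.filter fun y => g y = g x).card : ℝ) = N at *
    generalize ∑ y with g y = g x, f y = F at *
    rcases (hf x).eq_or_lt with h0 | h0
    · rw [← h0]
      have := hF.trans' (hf x)
      simp only [zero_mul, sub_zero]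
      positivity
    · have hF0 : 0 < F := h0.trans_le hF
      rw [← Real.logb_div (by positivity) (by positivity), Real.logb, ← mul_div_assoc]
      gcongr
      have := Real.log_le_sub_one_of_pos (x := F / f x / N) (by positivity)
      calc f x * Real.log (F / f x / N) ≤ f x * (F / f x / N - 1) := by gcongr
        _ = F / N - f x := by field_simp
  refine (Finset.sum_le_sum fun x _ => hterm x).trans ?_
  rw [← Finset.sum_div, Finset.sum_sub_distrib, hsum]
  have := sum_mul_blockSum_div_le g (a := fun _ => (1 : ℝ)) hf
  rw [hsum] at this
  exact div_nonpos_of_nonpos_of_nonneg (by linarith) hlog.le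

/-- The excess over log(F/f) is log(1 + 3N/(YF)) ≤ 3N/(YF log 2). Averaging N/F against f gives at
most the number of points, hence at most Y, which cancels. -/
theorem neg_le_sum_mul_logb_sub_logb_card (hf : ∀ x, 0 ≤ f x) (hsum : ∑ x, f x = 1)
    {C Y : ℝ} (hY : 0 < Y) (hcard : (Fintype.card ι : ℝ) ≤ Y)
    (h : ∀ x, 0 < f x → Real.logb 2 (Finset.univ.filter fun y => g y = g x).card ≤
      C + Real.logb 2 ((Y * (∑ y with g y = g x, f y) +
        3 * (Finset.univ.filter fun y => g y = g x).card) / (Y * f x))) :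
    -(C + 3 / Real.log 2) ≤ ∑ x, f x * (Real.logb 2 ((∑ y with g y = g x, f y) / f x) -
      Real.logb 2 (Finset.univ.filter fun y => g y = g x).card) := by
  have hlog : 0 < Real.log 2 := Real.log_pos (by norm_num)
  have hterm : ∀ x, -(f x * C + 3 / (Y * Real.log 2) *
      (f x * ((∑ y with g y = g x, (1 : ℝ)) / ∑ y with g y = g x, f y))) ≤
      f x * (Real.logb 2 ((∑ y with g y = g x, f y) / f x) -
        Real.logb 2 (Finset.univ.filter fun y => g y = g x).card) := by
    intro x
    have hN := card_block_pos g x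
    have hF := le_blockSum g hf x
    have hx := h x
    rw [Finset.sum_const, nsmul_eq_mul, mul_one]
    generalize ((Finset.univ.filter fun y => g y = g x).card : ℝ) = N at *
    generalize ∑ y with g y = g x, f y = F at *
    rcases (hf x).eq_or_lt with h0 | h0
    · rw [← h0]
      simp
    · have hF0 : 0 < F := h0.trans_le hF
      have h1 : (Y * F + 3 * N) / (Y * f x) = F / f x * (1 + 3 * N / (Y * F)) := by
        field_simp
      have h2 : Real.logb 2 (1 + 3 * N / (Y * F)) ≤ 3 / (Y * Real.log 2) * (N / F) := by
        rw [Real.logb, div_le_iff₀ hlog]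
        refine (Real.log_le_sub_one_of_pos (by positivity)).trans (le_of_eq ?_)
        field_simp
        ring
      have h3 := hx h0
      rw [h1, Real.logb_mul (by positivity) (by positivity)] at h3
      have : -(C + 3 / (Y * Real.log 2) * (N / F)) ≤ Real.logb 2 (F / f x) - Real.logb 2 N := by
        linarith
      calc _ = f x * -(C + 3 / (Y * Real.log 2) * (N / F)) := by ring
        _ ≤ _ := by gcongr
  refine le_trans ?_ (Finset.sum_le_sum fun x _ => hterm x)
  rw [Finset.sum_neg_distrib, Finset.sum_add_distrib, ← Finset.sum_mul, ← Finset.mul_sum, hsum,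
    one_mul]
  have h4 := sum_mul_blockSum_div_le g (a := f) (b := fun _ => (1 : ℝ)) fun _ => zero_le_one
  rw [Finset.sum_const, nsmul_eq_mul, mul_one, Finset.card_univ] at h4
  have h5 : 3 / (Y * Real.log 2) * ∑ x, f x * ((∑ y with g y = g x, (1 : ℝ)) /
      ∑ y with g y = g x, f y) ≤ 3 / (Y * Real.log 2) * Y := by
    gcongr
    exact h4.trans hcard
  have h6 : 3 / (Y * Real.log 2) * Y = 3 / Real.log 2 := by field_simp
  linarith

end BlockSums

/-! ### Sources and statistics -/

namespace SequentialSource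

theorem sum_mass_append (f : SequentialSource) (n : ℕ) (p : List Bool) :
    ∑ x : List.Vector Bool n, f.mass (p ++ x.toList) = f.mass p := by
  induction n generalizing p with
  | zero => simp
  | succ n ih =>
    let e : List.Vector Bool (n + 1) ≃ Bool × List.Vector Bool n :=
      ⟨fun v => (v.head, v.tail), fun a => a.1 ::ᵥ a.2, fun v => by simp, fun a => by simp⟩
    rw [← e.symm.sum_comp, Fintype.sum_prod_type, Fintype.sum_bool, ← f.mass_append p,
      ← ih (p ++ [false]), ← ih (p ++ [true]), add_comm]
    simp [e]

theorem sum_marginal (f : SequentialSource) (n : ℕ) : ∑ x, f.marginal n x = 1 := by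
  simpa [marginal, f.mass_nil] using f.sum_mass_append n []

end SequentialSource

namespace IsSequentialStatistic

variable {S : List Bool → Set (List Bool)}

/-- Two blocks of one partition that share an element coincide, so the blocks are the fibres of S at
each length. -/
theorem mem_iff (hS : IsSequentialStatistic S) {x y : List Bool} :
    y ∈ S x ↔ y.length = x.length ∧ S y = S x := by
  constructor
  · intro h
    have hl : y.length = x.length := hS.subset x h
    refine ⟨hl, ?_⟩
    by_contra hne
    exact Set.disjoint_left.1 ((hS.partition x.length).disjoint
      (Set.mem_image_of_mem S (show y ∈ {z : List Bool | z.length = x.length} from hl))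
      (Set.mem_image_of_mem S (show x ∈ {z : List Bool | z.length = x.length} from rfl)) hne)
      (hS.mem_self y) h
  · rintro ⟨-, h⟩
    exact h ▸ hS.mem_self y

theorem exists_isListing (hS : IsSequentialStatistic S) (x : List Bool) :
    ∃ l, KolmogorovComplexity.IsListing (S x) l := by
  have hfin : (S x).Finite := (List.finite_length_eq Bool x.length).subset (hS.subset x)
  exact ⟨hfin.toFinset.toList, Finset.nodup_toList _, fun y => by simp⟩

open Classical in
theorem toFinset_eq_map (hS : IsSequentialStatistic S) {n : ℕ} {x : List.Vector Bool n}
    {l : List (List Bool)} (hl : KolmogorovComplexity.IsListing (S x.toList) l) :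
    l.toFinset = (Finset.univ.filter fun y : List.Vector Bool n => S y.toList = S x.toList).map
      ⟨List.Vector.toList, List.Vector.toList_injective⟩ := by
  ext z
  rw [List.mem_toFinset, hl.2, hS.mem_iff]
  simp only [Finset.mem_map, Finset.mem_filter, Finset.mem_univ, true_and,
    Function.Embedding.coeFn_mk, List.Vector.toList_length]
  constructor
  · rintro ⟨h1, h2⟩
    exact ⟨⟨z, h1⟩, h2, rfl⟩
  · rintro ⟨y, hy, rfl⟩
    exact ⟨by simp, hy⟩

open Classical in
-- The shortest program may list the block in any order; total weights do not depend on it.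
theorem sum_map_listing (hS : IsSequentialStatistic S) {n : ℕ} {x : List.Vector Bool n}
    {l : List (List Bool)} (hl : KolmogorovComplexity.IsListing (S x.toList) l)
    {M : Type*} [AddCommMonoid M] (w : List Bool → M) :
    (l.map w).sum = ∑ y : List.Vector Bool n with S y.toList = S x.toList, w y.toList := by
  rw [← List.sum_toFinset _ hl.1, hS.toFinset_eq_map hl, Finset.sum_map]
  rfl

open Classical in
theorem ncard_eq (hS : IsSequentialStatistic S) {n : ℕ} (x : List.Vector Bool n) :
    (S x.toList).ncard =
      (Finset.univ.filter fun y : List.Vector Bool n => S y.toList = S x.toList).card := by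
  obtain ⟨l, hl⟩ := hS.exists_isListing x.toList
  have hcoe : S x.toList = (l.toFinset : Set (List Bool)) := by
    ext z
    simp [hl.2]
  rw [congrArg Set.ncard hcoe, Set.ncard_coe_finset, hS.toFinset_eq_map hl, Finset.card_map]

end IsSequentialStatistic

/-! ### Complexity -/

namespace KolmogorovComplexity

variable {U : List Bool →. ℕ}

/-- A finite infimum excludes an empty index set, and nonempty infima in ℕ∞ are attained. -/
theorem exists_mem_eq_biInf {ι : Type*} {s : Set ι} {g : ι → ℕ∞} (h : ⨅ i ∈ s, g i < ⊤) :
    ∃ i ∈ s, g i = ⨅ i ∈ s, g i := by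
  rw [iInf_subtype'] at h ⊢
  have : Nonempty s := by
    by_contra hne
    rw [not_nonempty_iff] at hne
    simp at h
  obtain ⟨i, hi⟩ := ENat.exists_eq_iInf fun i : s => g i
  exact ⟨i, i.2, hi⟩

theorem ofNat_le {a : ℕ} {p : List Bool} (h : a ∈ U p) : ofNat U a ≤ p.length :=
  iInf₂_le (f := fun (p : List Bool) (_ : p ∈ {p : List Bool | a ∈ U p}) => (p.length : ℕ∞)) p h

theorem ofNat_lt_top (hU : IsUniversalPrefixMachine U) (a : ℕ) : ofNat U a < ⊤ := by
  have hT : IsPrefixMachine fun p => ((if p = [] then some a else none : Option ℕ) : Part ℕ) := by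
    refine ⟨Computable.ofOption (Primrec.ite (Primrec.eq.comp Primrec.id (Primrec.const []))
      (Primrec.const (some a)) (Primrec.const none)).to_comp, fun p q hp hq _ => ?_⟩
    have h : ∀ p : List Bool,
        ((if p = [] then some a else none : Option ℕ) : Part ℕ).Dom → p = [] := by
      intro p hp
      by_contra hne
      simp [hne] at hp
    rw [h p hp, h q hq]
  obtain ⟨c, hc⟩ := hU.simulates _ hT
  obtain ⟨z, hz, -⟩ := hc [] a (by simp)
  exact (ofNat_le hz).trans_lt (ENat.natCast_lt_top _)

theorem exists_program_of_ofNat_lt_top {a : ℕ} (h : ofNat U a < ⊤) :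
    ∃ p, a ∈ U p ∧ (p.length : ℕ∞) = ofNat U a := by
  obtain ⟨p, hp, he⟩ := exists_mem_eq_biInf h
  exact ⟨p, hp, he⟩

theorem exists_program_ofSet (hU : IsUniversalPrefixMachine U) {s : Set (List Bool)}
    (hs : ∃ l, IsListing s l) :
    ∃ l p, IsListing s l ∧ Encodable.encode l ∈ U p ∧ (p.length : ℕ∞) = ofSet U s := by
  obtain ⟨l, hl⟩ := hs
  have hlt : ofSet U s < ⊤ := lt_of_le_of_lt
    (iInf₂_le (f := fun (l : List (List Bool)) (_ : l ∈ {l | IsListing s l}) =>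
      ofNat U (Encodable.encode l)) l hl) (ofNat_lt_top hU _)
  obtain ⟨l', hl', he⟩ := exists_mem_eq_biInf hlt
  obtain ⟨p, hp, hpl⟩ := exists_program_of_ofNat_lt_top (ofNat_lt_top hU (Encodable.encode l'))
  exact ⟨l', p, hl', hp, hpl.trans he⟩

theorem ComputesReal.exists_weight {i : ℕ} {f : List Bool → ℝ} (h : ComputesReal i f)
    (x : List Bool) : ∃ r, r ∈ (Denumerable.ofNat Nat.Partrec.Code i).eval
      (Nat.pair (Encodable.encode x) (2 ^ x.length)) ∧
      2 ^ x.length * f x ≤ ElementMachine.weight r x ∧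
      (ElementMachine.weight r x : ℝ) ≤ 2 ^ x.length * f x + 3 := by
  obtain ⟨p, q, hq, hr, habs⟩ := h x (2 ^ x.length) (by positivity)
  refine ⟨_, hr, ?_⟩
  simp only [ElementMachine.weight, Nat.unpair_pair]
  push_cast at habs ⊢
  rw [abs_lt, lt_div_iff₀ (by positivity), neg_lt, ← sub_pos] at habs
  have hY : (0 : ℝ) < 2 ^ x.length := by positivity
  have h1 : ((2 ^ x.length * p / q : ℕ) : ℝ) ≤ 2 ^ x.length * (p / q) := by
    refine Nat.cast_div_le.trans (le_of_eq ?_)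
    push_cast
    ring
  have h2 : 2 ^ x.length * ((p : ℝ) / q) < ((2 ^ x.length * p / q : ℕ) : ℝ) + 1 := by
    have := Nat.lt_floor_add_one (((2 ^ x.length * p : ℕ) : ℝ) / (q : ℝ))
    rw [Nat.floor_div_natCast, Nat.floor_natCast] at this
    rw [← mul_div_assoc]
    exact_mod_cast this
  have h3 : 2 ^ x.length * (f x - p / q) < 1 := by
    have := mul_lt_mul_of_pos_left (sub_pos.1 habs.1) hY
    rw [mul_one_div_cancel hY.ne'] at this
    linarith
  constructor <;> nlinarith [habs.2]

end KolmogorovComplexity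

open KolmogorovComplexity in
open scoped ENNReal NNReal in
-- With p a shortest program for a listing of S(x), simulating T gives K(x) ≤ |p| + |q| + d, while
-- sufficiency gives |p| + log|S(x)| ≤ K(x) + c; here |p| cancels.
theorem IsAlgorithmicallySufficient.exists_logb_ncard_le {U : List Bool →. ℕ}
    {S : List Bool → Set (List Bool)} (hsuff : IsAlgorithmicallySufficient U S)
    (hU : IsUniversalPrefixMachine U) (hS : IsSequentialStatistic S) {T : List Bool →. ℕ}
    (hT : IsPrefixMachine T) :
    ∃ C : ℝ, ∀ x : List Bool, ∃ (l : List (List Bool)) (p : List Bool),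
      IsListing (S x) l ∧ Encodable.encode l ∈ U p ∧
      ∀ q : List Bool, Encodable.encode x ∈ T (p ++ q) →
        Real.logb 2 (S x).ncard ≤ C + q.length := by
  obtain ⟨c, hc⟩ := hsuff
  obtain ⟨d, hd⟩ := hU.simulates T hT
  refine ⟨c + d, fun x => ?_⟩
  obtain ⟨l, p, hl, hp, hK⟩ := exists_program_ofSet hU (hS.exists_isListing x)
  refine ⟨l, p, hl, hp, fun q hq => ?_⟩
  obtain ⟨z, hz, hzl⟩ := hd _ _ hq
  have h1 := hc x
  have h2 : (ofString U x : ℝ≥0∞) ≤ ((z.length : ℕ∞) : ℝ≥0∞) :=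
    ENat.toENNReal_mono (ofNat_le hz)
  rw [← hK] at h1
  have h3 : ENNReal.ofReal (p.length + Real.logb 2 (S x).ncard) ≤
      ENNReal.ofReal (z.length + c) := by
    have hnn : 0 ≤ Real.logb 2 ((S x).ncard : ℝ) := by
      rcases Nat.eq_zero_or_pos (S x).ncard with h0 | h0
      · simp [h0]
      · exact Real.logb_nonneg (by norm_num) (by exact_mod_cast h0)
    rw [ENNReal.ofReal_add (by positivity) hnn, ENNReal.ofReal_add (by positivity) c.coe_nonneg]
    simpa using h1.trans (add_le_add_left h2 _)
  rw [ENNReal.ofReal_le_ofReal_iff (by positivity)] at h3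
  rw [List.length_append] at hzl
  have h4 : (z.length : ℝ) ≤ p.length + q.length + d := by exact_mod_cast hzl
  linarith

open Classical in
/-- For a fixed program, the bound is uniform in the sources which the program computes. -/
theorem exists_forall_expectedSufficiencyBound {U : List Bool →. ℕ}
    (hU : IsUniversalPrefixMachine U) {S : List Bool → Set (List Bool)}
    (hS : IsSequentialStatistic S) (hsuff : IsAlgorithmicallySufficient U S) (i : ℕ) :
    ∃ c : ℝ, ∀ f : SequentialSource, KolmogorovComplexity.ComputesReal i f.mass →
      ∀ n, ExpectedSufficiencyBound f S (uniformCond S) n c := by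
  obtain ⟨u, hu⟩ := Nat.Partrec.Code.exists_code.1 hU.isPrefixMachine.partrec
  have hu' : ∀ y, u.eval (Encodable.encode y) = U y := fun y => by
    rw [hu]
    simp only [Encodable.encodek, Part.coe_some, Part.bind_some]
    exact Part.map_id' (fun _ => rfl) _
  obtain ⟨C, hC⟩ := hsuff.exists_logb_ncard_le hU hS
    (ElementMachine.isPrefixMachine_machine hU.isPrefixMachine hu'
      (Denumerable.ofNat Nat.Partrec.Code i))
  -- C comes from sufficiency and simulation, 2 = log 4 from the codeword length, 3/log 2 from
  -- rounding. The absolute value makes the constant nonnegative, as the upper bound 0 requires.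
  refine ⟨|C + 2 + 3 / Real.log 2|, fun f hf n => ⟨fun x _ => ?_, ?_⟩⟩
  · rw [uniformCond, if_pos rfl]
    exact one_div_pos.2 (card_block_pos (fun y : List.Vector Bool n => S y.toList) x)
  have hnn : ∀ x, 0 ≤ f.marginal n x := fun x => f.mass_nonneg _
  have hterm : ∀ x : List.Vector Bool n, f.marginal n x *
      (Real.logb 2 (1 / f.condMass S n x (S x.toList)) -
        Real.logb 2 (1 / uniformCond S n x (S x.toList))) = f.marginal n x *
      (Real.logb 2 ((∑ y : List.Vector Bool n with S y.toList = S x.toList, f.marginal n y) /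
        f.marginal n x) - Real.logb 2
          (Finset.univ.filter fun y : List.Vector Bool n => S y.toList = S x.toList).card) := by
    intro x
    rw [SequentialSource.condMass, uniformCond, if_pos rfl, if_pos rfl, one_div_div, one_div_one_div]
  rw [Finset.sum_congr rfl fun x _ => hterm x]
  have hupper := sum_mul_logb_sub_logb_card_nonpos
    (fun y : List.Vector Bool n => S y.toList) hnn (f.sum_marginal n)
  have hlower := neg_le_sum_mul_logb_sub_logb_card
    (fun y : List.Vector Bool n => S y.toList) hnn (f.sum_marginal n) (C := C + 2)
    (Y := 2 ^ n) (by positivity) (by rw [card_vector]; simp) ?_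
  · exact abs_le.2 ⟨(neg_le_neg (le_abs_self _)).trans hlower, hupper.trans (abs_nonneg _)⟩
  intro x hx
  choose r hr hrl hru using hf.exists_weight
  obtain ⟨l, p, hl, hp, hq⟩ := hC x.toList
  obtain ⟨q, hqw, hqm⟩ := ElementMachine.exists_mem_machine hU.isPrefixMachine hu'
    (fun z _ => hr z) hp ((hl.2 _).2 (hS.mem_self x.toList))
  have h1 := hq q hqm
  rw [hS.ncard_eq] at h1
  refine h1.trans ?_
  rw [add_assoc]
  gcongr
  rw [hS.sum_map_listing hl] at hqw
  have hN := card_block_pos (fun y : List.Vector Bool n => S y.toList) x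
  have hF := le_blockSum (fun y : List.Vector Bool n => S y.toList) hnn x
  have hsum : ((∑ y : List.Vector Bool n with S y.toList = S x.toList,
      ElementMachine.weight (r y.toList) y.toList : ℕ) : ℝ) ≤
      2 ^ n * (∑ y : List.Vector Bool n with S y.toList = S x.toList, f.marginal n y) +
        3 * (Finset.univ.filter fun y : List.Vector Bool n => S y.toList = S x.toList).card := by
    push_cast
    rw [Finset.mul_sum, mul_comm (3 : ℝ), ← nsmul_eq_mul, ← Finset.sum_const,
      ← Finset.sum_add_distrib]
    refine Finset.sum_le_sum fun y _ => ?_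
    simpa [SequentialSource.marginal] using hru y.toList
  have hw : 2 ^ n * f.marginal n x ≤ ElementMachine.weight (r x.toList) x.toList := by
    simpa [SequentialSource.marginal] using hrl x.toList
  -- The codeword bound 2^|q| w ≤ 4W, with w bounded below and W above in terms of f.
  have hpow : (2 : ℝ) ^ q.length * (2 ^ n * f.marginal n x) ≤
      4 * (2 ^ n * (∑ y : List.Vector Bool n with S y.toList = S x.toList, f.marginal n y) +
        3 * (Finset.univ.filter fun y : List.Vector Bool n => S y.toList = S x.toList).card) :=
    calc _ ≤ (2 : ℝ) ^ q.length * ElementMachine.weight (r x.toList) x.toList := by gcongr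
      _ ≤ 4 * ((∑ y : List.Vector Bool n with S y.toList = S x.toList,
          ElementMachine.weight (r y.toList) y.toList : ℕ) : ℝ) := by exact_mod_cast hqw
      _ ≤ _ := by gcongr
  clear hsum
  have hF0 := hx.trans_le hF
  generalize ((Finset.univ.filter fun y : List.Vector Bool n => S y.toList = S x.toList).card : ℝ)
    = N at *
  generalize ∑ y : List.Vector Bool n with S y.toList = S x.toList, f.marginal n y = F at *
  have h4 : (2 : ℝ) = Real.logb 2 4 := by
    rw [show (4 : ℝ) = 2 ^ (2 : ℝ) by norm_num, Real.logb_rpow (by norm_num) (by norm_num)]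
  have hlen : (q.length : ℝ) = Real.logb 2 (2 ^ q.length) := by
    rw [← Real.rpow_natCast, Real.logb_rpow (by norm_num) (by norm_num)]
  have hlog := Real.logb_le_logb_of_le (b := 2) (by norm_num) (by positivity)
    ((le_div_iff₀ (by positivity)).2 hpow)
  rw [mul_div_assoc, Real.logb_mul (by norm_num) (by positivity), ← h4, ← hlen] at hlog
  exact hlog

theorem mainTheorem1 (U : List Bool →. ℕ) (hU : IsUniversalPrefixMachine U)
    (S : List Bool → Set (List Bool)) (hS : IsSequentialStatistic S)
    (hsuff : IsAlgorithmicallySufficient U S)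
    {Θ : Type*} (f : Θ → SequentialSource) :
    (∀ θ : Θ, (f θ).complexity U < ⊤ →
      ∃ c : ℝ, ∀ n : ℕ, ExpectedSufficiencyBound (f θ) S (uniformCond S) n c) ∧
    ((⨆ θ : Θ, (f θ).complexity U) < ⊤ →
      NearlySufficientWith f S (uniformCond S) ∧ NearlySufficient f S) := by
  choose c hc using exists_forall_expectedSufficiencyBound hU hS hsuff
  refine ⟨fun θ hθ => ?_, fun hsup => ?_⟩
  · obtain ⟨i, hi, -⟩ := KolmogorovComplexity.exists_mem_eq_biInf hθ
    exact ⟨c i, hc i _ hi⟩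
  · suffices h : NearlySufficientWith f S (uniformCond S) from ⟨h, _, h⟩
    lift (⨆ θ : Θ, (f θ).complexity U) to ℕ using hsup.ne with B hB
    -- There are finitely many programs of length at most B, each with at most one output, so only
    -- finitely many indices i and constants c i occur.
    have hfin : {i : ℕ | ∃ p : List Bool, p.length ≤ B ∧ i ∈ U p}.Finite := by
      refine ((List.finite_length_le Bool B).biUnion (t := fun p => {i | i ∈ U p})
        fun p _ => Set.Subsingleton.finite fun i hi j hj => Part.mem_unique hi hj).subset ?_
      rintro i ⟨p, hp, hi⟩
      exact Set.mem_biUnion hp hi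
    obtain ⟨M, hM⟩ := (hfin.image c).bddAbove
    refine ⟨M, fun θ n => ?_⟩
    have hle : (f θ).complexity U ≤ B := hB ▸ le_iSup (fun θ => (f θ).complexity U) θ
    obtain ⟨i, hi, he⟩ := KolmogorovComplexity.exists_mem_eq_biInf
      (hle.trans_lt (ENat.natCast_lt_top B))
    have hiB : KolmogorovComplexity.ofNat U i ≤ B := he.trans_le hle
    obtain ⟨p, hp, hpl⟩ := KolmogorovComplexity.exists_program_of_ofNat_lt_top
      (hiB.trans_lt (ENat.natCast_lt_top B))
    have hpB : p.length ≤ B := by exact_mod_cast hpl.trans_le hiB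
    obtain ⟨hpos, habs⟩ := hc i (f θ) hi n
    exact ⟨hpos, habs.trans (hM ⟨i, ⟨p, hpB, hp⟩, rfl⟩)⟩
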